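/- Let $\Omega$ be a finite set, let $G$ be a primitive permutation group on $\Omega$ (that is, $G$ is transitive and preserves no non-trivial partition of $\Omega$), and let $t:\Omega\to\Omega$ be a map of rank $2$ which is not a permutation. Let $S=\langle G,t\rangle\setminus G$, let $\ker(t)$ be the partition of $\Omega$ into the two fibres of $t$, let $\Omega t$ be the image of $t$, and let $I$ and $\Lambda$ be the $G$-orbits of $\ker(t)$ and of $\Omega t$. The Houghton graph is the bipartite graph with vertex set the disjoint union of $I$ and $\Lambda$, in which a partition $Q\in I$ is joined to a $2$-set $L\in\Lambda$ whenever $L$ is a transversal for $Q$ (meets each part of $Q$ in exactly one point). For a group $H$ and a matrix $P=(p_{\lambda i})_{\lambda\in\Lambda',\,i\in I'}$ with entries in $H\cup\{0\}$ which is regular (every row and every column has a non-zero entry), the Rees matrix semigroup $M^0[H;I',\Lambda';P]$ is the set $(I'\times H\times\Lambda')\cup\{0\}$ with $(i,g,\lambda)(j,h,\mu)=(i,g\,p_{\lambda j}\,h,\mu)$ if $p_{\lambda j}\ne0$, and all other products equal to $0$. It is called connected if the graph on the pairs $(i,\lambda)$ with $p_{\lambda i}\neq 0$, two distinct pairs being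 adjacent when they agree in a coordinate, is connected. Let $S'$ be the set of rank $2$ maps in $S$ together with a symbol $0$, where the product of two maps is their composite (from left to right) if this has rank $2$, and every other product is $0$. Then: 1. $S$ is generated by its idempotents if and only if the Houghton graph is connected. 2. $S'$ is isomorphic to a Rees matrix semigroup $M^0[S_2;I,\Lambda;P]$, where $S_2$ is the symmetric group of degree $2$, $P$ is regular, and $p_{\lambda i}\ne 0$ if and only if $\lambda$ is a transversal for $i$. 3. For every Rees matrix semigroup $M^0[H;I',\Lambda';P]$ with $P$ regular which is isomorphic to $S'$, $S$ is generated by its idempotents if and only if $M^0[H;I',\Lambda';P]$ is connected. -/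

import Mathlib

open scoped Pointwise

/-- The rank of a transformation: the number of points in its image. -/
noncomputable def trRank {Ω : Type*} (f : Function.End Ω) : ℕ := (Set.range f).ncard

/-- The elements of a permutation group, seen as transformations. -/
def permMaps {Ω : Type*} (G : Subgroup (Equiv.Perm Ω)) : Set (Function.End Ω) :=
  {f | ∃ g ∈ G, f = (g : Ω → Ω)}

/-- The set `⟨G, t⟩ \ G`, where `⟨G, t⟩` is the semigroup generated by `G` and `t`. -/
def genDiff {Ω : Type*} (G : Subgroup (Equiv.Perm Ω)) (t : Function.End Ω) :
    Set (Function.End Ω) :=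
  (Subsemigroup.closure (permMaps G ∪ {t}) : Set (Function.End Ω)) \ permMaps G

/-- `A` is idempotent generated: `A = ⟨E(A)⟩`, with `E(A)` the set of idempotents of `A`. -/
def IsIdempotentGenerated {M : Type*} [Mul M] (A : Set M) : Prop :=
  A = Subsemigroup.closure {e | e ∈ A ∧ IsIdempotentElem e}

/-- The partition of the domain into the kernel classes (the nonempty fibres) of a map. -/
def kerPartition {Ω : Type*} (t : Function.End Ω) : Set (Set Ω) :=
  (Setoid.ker (t : Ω → Ω)).classes

/-- `S` is a transversal (section) for the partition `P`: it meets every part in exactly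
one point. -/
def IsTransversalFor {Ω : Type*} (S : Set Ω) (P : Set (Set Ω)) : Prop :=
  ∀ A ∈ P, ∃! x, x ∈ S ∧ x ∈ A

/-- The Houghton graph: the bipartite graph on the disjoint union of the `G`-orbit of the
partition `P` and the `G`-orbit of the set `S`, with a partition joined to each set that is a
transversal for it. -/
def houghtonGraph {Ω : Type*} (G : Subgroup (Equiv.Perm Ω)) (P : Set (Set Ω)) (S : Set Ω) :
    SimpleGraph (MulAction.orbit G P ⊕ MulAction.orbit G S) where
  Adj
    | .inl P', .inr S' => IsTransversalFor S'.1 P'.1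
    | .inr S', .inl P' => IsTransversalFor S'.1 P'.1
    | _, _ => False
  symm := ⟨by rintro (a | a) (b | b) h <;> exact h⟩
  loopless := ⟨by rintro (a | a) h <;> exact h⟩

/-- The matrix `P` over a group with zero is regular: no zero row and no zero column. -/
def IsRegularMatrix {H I L : Type*} (P : L → I → WithZero H) : Prop :=
  (∀ l, ∃ i, P l i ≠ 0) ∧ (∀ i, ∃ l, P l i ≠ 0)

/-- The underlying set `(I × H × L) ∪ {0}` of the Rees matrix semigroup `M⁰[H; I, L; P]`. -/
inductive ReesMatrixSemigroup {H I L : Type*} (P : L → I → WithZero H) where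
  | zero : ReesMatrixSemigroup P
  | elem (i : I) (g : H) (l : L) : ReesMatrixSemigroup P

namespace ReesMatrixSemigroup

open Classical in
/-- `(i, g, l) (j, h, m) = (i, g p_{lj} h, m)` if `p_{lj} ≠ 0`, all other products are `0`. -/
noncomputable instance instMul {H I L : Type*} [Group H] (P : L → I → WithZero H) :
    Mul (ReesMatrixSemigroup P) where
  mul
    | .elem i g l, .elem j h m =>
        if hp : P l j ≠ 0 then .elem i (g * WithZero.unzero hp * h) m else .zero
    | _, _ => .zero

theorem elem_mul_elem {H I L : Type*} [Group H] {P : L → I → WithZero H} (i j : I) (g h : H)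
    (l m : L) (hp : P l j ≠ 0) :
    (elem i g l * elem j h m : ReesMatrixSemigroup P) =
      elem i (g * WithZero.unzero hp * h) m :=
  dif_pos hp

theorem elem_mul_elem_eq_zero {H I L : Type*} [Group H] {P : L → I → WithZero H} (i j : I)
    (g h : H) (l m : L) (hp : P l j = 0) :
    (elem i g l * elem j h m : ReesMatrixSemigroup P) = zero :=
  dif_neg (not_not.mpr hp)

theorem zero_mul' {H I L : Type*} [Group H] {P : L → I → WithZero H}
    (x : ReesMatrixSemigroup P) : zero * x = zero := by
  cases x <;> rfl

theorem mul_zero' {H I L : Type*} [Group H] {P : L → I → WithZero H}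
    (x : ReesMatrixSemigroup P) : x * zero = zero := by
  cases x <;> rfl

theorem mul_assoc' {H I L : Type*} [Group H] {P : L → I → WithZero H}
    (x y z : ReesMatrixSemigroup P) : x * y * z = x * (y * z) := by
  rcases x with _ | ⟨i, g, l⟩
  · rw [zero_mul', zero_mul', zero_mul']
  rcases y with _ | ⟨j, h, m⟩
  · rw [zero_mul', mul_zero', zero_mul']
  rcases z with _ | ⟨k, f, n⟩
  · rw [mul_zero', mul_zero', mul_zero']
  by_cases h1 : P l j = 0 <;> by_cases h2 : P m k = 0
  · rw [elem_mul_elem_eq_zero _ _ _ _ _ _ h1, elem_mul_elem_eq_zero _ _ _ _ _ _ h2,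
      zero_mul', mul_zero']
  · rw [elem_mul_elem_eq_zero _ _ _ _ _ _ h1, elem_mul_elem _ _ _ _ _ _ h2, zero_mul',
      elem_mul_elem_eq_zero _ _ _ _ _ _ h1]
  · rw [elem_mul_elem _ _ _ _ _ _ h1, elem_mul_elem_eq_zero _ _ _ _ _ _ h2,
      elem_mul_elem_eq_zero _ _ _ _ _ _ h2, mul_zero']
  · rw [elem_mul_elem _ _ _ _ _ _ h1, elem_mul_elem _ _ _ _ _ _ h2,
      elem_mul_elem _ _ _ _ _ _ h2, elem_mul_elem _ _ _ _ _ _ h1]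
    simp only [mul_assoc]

noncomputable instance {H I L : Type*} [Group H] (P : L → I → WithZero H) :
    Semigroup (ReesMatrixSemigroup P) where
  mul_assoc := mul_assoc'

end ReesMatrixSemigroup

/-- The graph whose vertices are the pairs `(i, l)` with `p_{li} ≠ 0`, two different pairs being
adjacent when they agree in a coordinate. -/
def reesGraph {H I L : Type*} (P : L → I → WithZero H) :
    SimpleGraph {c : I × L // P c.2 c.1 ≠ 0} where
  Adj c d := c ≠ d ∧ (c.1.1 = d.1.1 ∨ c.1.2 = d.1.2)
  symm := ⟨fun _ _ h => ⟨h.1.symm, h.2.imp Eq.symm Eq.symm⟩⟩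
  loopless := ⟨fun _ h => h.1 rfl⟩

/-- The Rees matrix semigroup with sandwich matrix `P` is connected. -/
def ReesConnected {H I L : Type*} (P : L → I → WithZero H) : Prop :=
  (reesGraph P).Connected

/-- The set of the rank `k` elements of `A`, together with an extra symbol `0`. -/
inductive RankFactor {Ω : Type*} (A : Set (Function.End Ω)) (k : ℕ) where
  | zero : RankFactor A k
  | elem (f : Function.End Ω) (hf : f ∈ A ∧ trRank f = k) : RankFactor A k

open Classical in
/-- Maps are composed from left to right: the product of `f` and `g` is `f` followed by `g` if
this map has rank `k`, and `0` otherwise; all products with `0` are `0`. (The condition that the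
composite lies in `A` is automatic when `A` is a semigroup.) -/
noncomputable instance {Ω : Type*} (A : Set (Function.End Ω)) (k : ℕ) :
    Mul (RankFactor A k) where
  mul
    | .elem f _, .elem g _ =>
        if h : (g * f) ∈ A ∧ trRank (g * f) = k then .elem (g * f) h else .zero
    | _, _ => .zero

/-! Label the two classes of every partition in I and the two points of every set in Λ. A rank 2 map
with kernel Q and image L becomes a triple (Q, π, L) with π ∈ S_2, and a composite of two triples
has rank 2 exactly when the intermediate image is a transversal for the next kernel. Primitivity
puts every triple in S: some g ∈ G moves two given points to prescribed sides of a partition, since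
otherwise inseparable points would form a non-trivial block, and so the maps tgt realise every π.
This is the Rees matrix representation.

A rank 2 product of idempotents traces a path in the Houghton graph from its kernel to its image, so
idempotent generation forces connectedness. Conversely, paths yield, for each pair (Q, L), at least
one map in the semigroup E generated by the idempotents; the difficulty is to get both. If one pair
had only one map, then so would all (`forall_map_mem_of_two`), and the maps in E with kernel Q would
orient the sets in Λ as arcs on Ω. As G normalises E, each g ∈ G preserves or reverses this
orientation (`edge_smul_or_edge_smul`). The preserving subgroup is normal and, as |Ω| ≥ 3,
non-trivial, hence transitive; by counting, an arc entering a class of Q forces an arc leaving it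
(`exists_edge_leaving`). Two arcs crossing Q in opposite directions give two maps in E with the same
kernel and image, a contradiction.

For an arbitrary Rees representation, the graph on its non-zero matrix entries is recovered from the
idempotents, so its connectedness is an isomorphism invariant. For the coordinate matrix it is the
line graph of the Houghton graph. -/

/-! ### Counting in transitive groups and separation in primitive groups -/

theorem smul_mem_of_forall_smul_mem {K α : Type*} [Group K] [Finite K] [MulAction K α]
    [MulAction.IsPretransitive K α] {x y : α} {B : Set α}
    (h : ∀ g : K, g • x ∈ B → g • y ∈ B) (g : K) (hg : g • y ∈ B) : g • x ∈ B := by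
  obtain ⟨k, hk⟩ := MulAction.exists_smul_eq K x y
  -- With k • x = y, right multiplication by k carries the first set onto the second.
  have hcard : {g : K | g • y ∈ B}.ncard = {g : K | g • x ∈ B}.ncard := by
    rw [← Set.ncard_image_of_injective {g : K | g • y ∈ B} (mul_left_injective k)]
    congr 1
    ext a
    constructor
    · rintro ⟨b, hb, rfl⟩
      simpa [mul_smul, hk] using hb
    · intro ha
      refine ⟨a * k⁻¹, ?_, by simp⟩
      simpa [mul_smul, ← hk] using ha
  have heq : {g : K | g • x ∈ B} = {g : K | g • y ∈ B} :=
    Set.eq_of_subset_of_ncard_le (fun a ha => h a ha) hcard.le (Set.toFinite _)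
  exact (Set.ext_iff.1 heq g).2 hg

/-- If no g works, counting upgrades the implication to an equivalence, so y lies in the class of x
for the relation "moved into B by the same group elements". This class is a block with two points,
hence everything, and transitivity then makes B everything. -/
theorem MulAction.IsPreprimitive.exists_smul_mem_smul_notMem {K α : Type*} [Group K] [Finite K]
    [MulAction K α] [MulAction.IsPreprimitive K α] {x y : α} (hxy : x ≠ y) {B : Set α}
    (hB : B.Nonempty) (hB' : B ≠ Set.univ) : ∃ g : K, g • x ∈ B ∧ g • y ∉ B := by
  by_contra! hc
  have hiff : ∀ g : K, g • x ∈ B ↔ g • y ∈ B :=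
    fun g => ⟨hc g, smul_mem_of_forall_smul_mem hc g⟩
  let C : Set α := {z | ∀ g : K, g • x ∈ B ↔ g • z ∈ B}
  have hC : MulAction.IsBlock K C := by
    rw [MulAction.isBlock_iff_smul_eq_of_nonempty]
    rintro g ⟨z, ⟨w, hw, hwz⟩, hz⟩
    have key : ∀ k : K, k • x ∈ B ↔ (k * g) • x ∈ B := fun k => by
      rw [hz k, hw (k * g), ← hwz, mul_smul]
    ext v
    rw [Set.mem_smul_set_iff_inv_smul_mem]
    constructor
    · intro hv k
      rw [key, hv, mul_smul, smul_inv_smul]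
    · intro hv k
      have h1 := key (k * g⁻¹)
      rw [inv_mul_cancel_right] at h1
      rw [← h1, hv, mul_smul]
  rcases MulAction.IsPreprimitive.isTrivialBlock_of_isBlock hC with h | h
  · exact hxy (h (fun _ => Iff.rfl) hiff)
  · obtain ⟨b, hb⟩ := hB
    obtain ⟨k, rfl⟩ := MulAction.exists_smul_eq K x b
    refine hB' (Set.eq_univ_of_forall fun z => ?_)
    have hz : k⁻¹ • z ∈ C := h ▸ Set.mem_univ _
    simpa using (hz k).1 hb

/-! ### Coordinates for the rank 2 maps -/

theorem Fin.ne_iff_eq_of_ne {a b : Fin 2} (h : a ≠ b) (c : Fin 2) : c ≠ a ↔ c = b := by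
  revert a b c; decide

theorem permFinTwo_mul_comm (a b : Equiv.Perm (Fin 2)) : a * b = b * a := by
  revert a b; decide

theorem permFinTwo_eq_or_eq {a b : Equiv.Perm (Fin 2)} (h : a ≠ b) (c : Equiv.Perm (Fin 2)) :
    c = a ∨ c = b := by
  revert a b c; decide

/-- Coordinates for the orbit of a kernel of two classes and the orbit of a set of two points:
each partition is the kernel of a map onto `Fin 2`, each set the image of `Fin 2`. -/
structure Coordinates {Ω : Type*} (G : Subgroup (Equiv.Perm Ω)) (t : Function.End Ω) where
  proj : MulAction.orbit G (kerPartition t) → Ω → Fin 2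
  proj_surjective : ∀ Q, Function.Surjective (proj Q)
  classes_proj : ∀ Q, (Setoid.ker (proj Q)).classes = Q.1
  incl : MulAction.orbit G (Set.range (t : Ω → Ω)) → Fin 2 → Ω
  incl_injective : ∀ L, Function.Injective (incl L)
  range_incl : ∀ L, Set.range (incl L) = L.1

theorem smul_classes_ker {Ω β : Type*} (G : Subgroup (Equiv.Perm Ω)) (g : G) (f : Ω → β) :
    g • (Setoid.ker f).classes = (Setoid.ker fun x => f (g⁻¹ • x)).classes := by
  ext A
  constructor
  · rintro ⟨_, ⟨y, rfl⟩, rfl⟩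
    refine ⟨g • y, ?_⟩
    ext x
    simp [Set.mem_smul_set_iff_inv_smul_mem, Setoid.ker_def]
  · rintro ⟨y, rfl⟩
    refine ⟨_, ⟨g⁻¹ • y, rfl⟩, ?_⟩
    ext x
    simp [Set.mem_smul_set_iff_inv_smul_mem, Setoid.ker_def]

theorem smul_range_eq {Ω β : Type*} (G : Subgroup (Equiv.Perm Ω)) (g : G) (f : β → Ω) :
    g • Set.range f = Set.range fun x => g • f x := by
  rw [← Set.image_smul, ← Set.range_comp]; rfl

theorem Coordinates.nonempty {Ω : Type*} (G : Subgroup (Equiv.Perm Ω)) {t : Function.End Ω}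
    (ht : trRank t = 2) : Nonempty (Coordinates G t) := by
  have : Finite (Set.range (t : Ω → Ω)) :=
    Set.finite_of_ncard_ne_zero (by rw [show (Set.range t).ncard = 2 from ht]; simp)
  let e : Set.range (t : Ω → Ω) ≃ Fin 2 := Finite.equivFinOfCardEq (by
    rw [Nat.card_coe_set_eq]; exact ht)
  have hproj : ∀ Q : MulAction.orbit G (kerPartition t), ∃ f : Ω → Fin 2,
      Function.Surjective f ∧ (Setoid.ker f).classes = Q.1 := by
    rintro ⟨_, g, rfl⟩
    refine ⟨fun x => e ⟨t (g⁻¹ • x), Set.mem_range_self _⟩, fun c => ?_, ?_⟩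
    · obtain ⟨x, hx⟩ := (e.symm c).2
      refine ⟨g • x, ?_⟩
      have h : (⟨(t : Ω → Ω) (g⁻¹ • g • x), Set.mem_range_self _⟩ : Set.range (t : Ω → Ω)) =
          e.symm c := Subtype.ext ((congrArg (t : Ω → Ω) (inv_smul_smul g x)).trans hx)
      exact (congrArg e h).trans (e.apply_symm_apply c)
    · refine Eq.trans ?_ (smul_classes_ker G g (t : Ω → Ω)).symm
      congr 1
      ext x y
      exact e.injective.eq_iff.trans Subtype.ext_iff
  have hincl : ∀ L : MulAction.orbit G (Set.range (t : Ω → Ω)), ∃ f : Fin 2 → Ω,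
      Function.Injective f ∧ Set.range f = L.1 := by
    rintro ⟨_, g, rfl⟩
    refine ⟨fun c => g • (e.symm c).1, fun c d h => ?_, ?_⟩
    · exact e.symm.injective (Subtype.ext (MulAction.injective g h))
    · change _ = g • Set.range t
      rw [← smul_range_eq G g fun c => (e.symm c).1]
      congr 1
      ext x
      constructor
      · rintro ⟨c, rfl⟩
        exact (e.symm c).2
      · intro hx
        exact ⟨e ⟨x, hx⟩, by simp⟩
  choose f hf hf' using hproj
  choose m hm hm' using hincl
  exact ⟨⟨f, hf, hf', m, hm, hm'⟩⟩

namespace Coordinates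

variable {Ω : Type*} {G : Subgroup (Equiv.Perm Ω)} {t : Function.End Ω} (c : Coordinates G t)

/-- The map with kernel `Q` and image `L` that acts on the coordinates as `π`. -/
def map (Q : MulAction.orbit G (kerPartition t)) (π : Equiv.Perm (Fin 2))
    (L : MulAction.orbit G (Set.range (t : Ω → Ω))) : Function.End Ω :=
  fun x => c.incl L (π (c.proj Q x))

theorem map_apply (Q : MulAction.orbit G (kerPartition t)) (π : Equiv.Perm (Fin 2))
    (L : MulAction.orbit G (Set.range (t : Ω → Ω))) (x : Ω) :
    c.map Q π L x = c.incl L (π (c.proj Q x)) := rfl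

theorem kerPartition_map (Q : MulAction.orbit G (kerPartition t)) (π : Equiv.Perm (Fin 2))
    (L : MulAction.orbit G (Set.range (t : Ω → Ω))) : kerPartition (c.map Q π L) = Q.1 := by
  rw [← c.classes_proj Q, kerPartition]
  congr 1
  ext x y
  exact (c.incl_injective L).eq_iff.trans π.injective.eq_iff

theorem range_map (Q : MulAction.orbit G (kerPartition t)) (π : Equiv.Perm (Fin 2))
    (L : MulAction.orbit G (Set.range (t : Ω → Ω))) :
    Set.range (c.map Q π L : Ω → Ω) = L.1 := by
  rw [← c.range_incl L]
  exact (π.surjective.comp (c.proj_surjective Q)).range_comp (c.incl L)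

theorem trRank_map (Q : MulAction.orbit G (kerPartition t)) (π : Equiv.Perm (Fin 2))
    (L : MulAction.orbit G (Set.range (t : Ω → Ω))) : trRank (c.map Q π L) = 2 := by
  rw [trRank, range_map, ← c.range_incl L, ← Set.image_univ,
    Set.ncard_image_of_injective _ (c.incl_injective L)]
  simp

theorem map_inj {Q Q' : MulAction.orbit G (kerPartition t)} {π π' : Equiv.Perm (Fin 2)}
    {L L' : MulAction.orbit G (Set.range (t : Ω → Ω))} :
    c.map Q π L = c.map Q' π' L' ↔ Q = Q' ∧ π = π' ∧ L = L' := by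
  constructor
  · intro h
    have hQ : Q = Q' := Subtype.ext (by rw [← c.kerPartition_map Q π L, h, kerPartition_map])
    have hL : L = L' := Subtype.ext (by rw [← c.range_map Q π L, h, range_map])
    subst hQ hL
    refine ⟨rfl, Equiv.ext fun a => ?_, rfl⟩
    obtain ⟨x, rfl⟩ := c.proj_surjective Q a
    exact c.incl_injective L (congrFun h x)
  · rintro ⟨rfl, rfl, rfl⟩; rfl

theorem exists_eq_map {f : Function.End Ω} {Q : MulAction.orbit G (kerPartition t)}
    {L : MulAction.orbit G (Set.range (t : Ω → Ω))} (hQ : kerPartition f = Q.1)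
    (hL : Set.range (f : Ω → Ω) = L.1) : ∃ π, f = c.map Q π L := by
  have hker : Setoid.ker (f : Ω → Ω) = Setoid.ker (c.proj Q) :=
    Setoid.classes_inj.2 (hQ.trans (c.classes_proj Q).symm)
  have hker' : ∀ x y, f x = f y ↔ c.proj Q x = c.proj Q y := fun x y => by
    change Setoid.ker (f : Ω → Ω) x y ↔ Setoid.ker (c.proj Q) x y
    rw [hker]
  have hsec := Function.surjInv_eq (c.proj_surjective Q)
  set s := Function.surjInv (c.proj_surjective Q)
  have hex : ∀ a, ∃ b, c.incl L b = f (s a) := fun a => by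
    have h : f (s a) ∈ Set.range (f : Ω → Ω) := Set.mem_range_self _
    rwa [hL, ← c.range_incl L] at h
  choose p hp using hex
  have hinj : Function.Injective p := fun a b h => by
    have h1 := hp a
    rw [h, hp b, hker', hsec, hsec] at h1
    exact h1.symm
  refine ⟨Equiv.ofBijective p (Finite.injective_iff_bijective.1 hinj), funext fun x => ?_⟩
  rw [map_apply, Equiv.ofBijective_apply, hp, hker', hsec]

theorem isTransversalFor_iff {Q : MulAction.orbit G (kerPartition t)}
    {L : MulAction.orbit G (Set.range (t : Ω → Ω))} :
    IsTransversalFor L.1 Q.1 ↔ Function.Bijective fun a => c.proj Q (c.incl L a) := by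
  rw [← c.classes_proj Q, ← c.range_incl L]
  constructor
  · intro h
    refine Finite.surjective_iff_bijective.1 fun a => ?_
    obtain ⟨x, rfl⟩ := c.proj_surjective Q a
    obtain ⟨_, ⟨⟨b, rfl⟩, hb⟩, -⟩ := h _ ⟨x, rfl⟩
    exact ⟨b, hb⟩
  · rintro h _ ⟨x, rfl⟩
    obtain ⟨b, hb⟩ := h.2 (c.proj Q x)
    refine ⟨c.incl L b, ⟨⟨b, rfl⟩, hb⟩, ?_⟩
    rintro _ ⟨⟨b', rfl⟩, hb'⟩
    rw [h.1 (hb'.trans hb.symm)]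

open Classical in
/-- The sandwich matrix of the given coordinates. -/
noncomputable def matrix (L : MulAction.orbit G (Set.range (t : Ω → Ω)))
    (Q : MulAction.orbit G (kerPartition t)) : WithZero (Equiv.Perm (Fin 2)) :=
  if h : Function.Bijective fun a => c.proj Q (c.incl L a) then
    (Equiv.ofBijective _ h : Equiv.Perm (Fin 2)) else 0

theorem matrix_ne_zero_iff {Q : MulAction.orbit G (kerPartition t)}
    {L : MulAction.orbit G (Set.range (t : Ω → Ω))} :
    c.matrix L Q ≠ 0 ↔ IsTransversalFor L.1 Q.1 := by
  rw [c.isTransversalFor_iff, matrix]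
  split_ifs with h
  · exact iff_of_true WithZero.coe_ne_zero h
  · exact iff_of_false (fun h0 => h0 rfl) h

theorem unzero_matrix_apply {Q : MulAction.orbit G (kerPartition t)}
    {L : MulAction.orbit G (Set.range (t : Ω → Ω))} (h : c.matrix L Q ≠ 0) (a : Fin 2) :
    WithZero.unzero h a = c.proj Q (c.incl L a) := by
  have hb := c.isTransversalFor_iff.1 (c.matrix_ne_zero_iff.1 h)
  have h1 : WithZero.unzero h = Equiv.ofBijective _ hb := by
    rw [← WithZero.coe_inj, WithZero.coe_unzero, matrix, dif_pos hb]
  rw [h1, Equiv.ofBijective_apply]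

theorem map_mul_map {Q Q' : MulAction.orbit G (kerPartition t)} {π π' : Equiv.Perm (Fin 2)}
    {L L' : MulAction.orbit G (Set.range (t : Ω → Ω))} (h : c.matrix L Q' ≠ 0) :
    c.map Q' π' L' * c.map Q π L = c.map Q (π' * WithZero.unzero h * π) L' := by
  funext x
  change c.map Q' π' L' (c.map Q π L x) = _
  simp [map_apply, unzero_matrix_apply]

theorem matrix_ne_zero_of_trRank {Q Q' : MulAction.orbit G (kerPartition t)}
    {π π' : Equiv.Perm (Fin 2)} {L L' : MulAction.orbit G (Set.range (t : Ω → Ω))}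
    (h : trRank (c.map Q' π' L' * c.map Q π L) = 2) : c.matrix L Q' ≠ 0 := by
  rw [c.matrix_ne_zero_iff, c.isTransversalFor_iff, ← Finite.injective_iff_bijective]
  by_contra hinj
  have hconst : ∀ a, c.proj Q' (c.incl L a) = c.proj Q' (c.incl L 0) := by
    have h01 : c.proj Q' (c.incl L 1) = c.proj Q' (c.incl L 0) := by
      by_contra hne
      refine hinj fun a b hab => ?_
      fin_cases a <;> fin_cases b <;> simp_all
    intro a
    fin_cases a
    · rfl
    · exact h01
  have : Set.range (c.map Q' π' L' * c.map Q π L : Function.End Ω) ⊆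
      {c.incl L' (π' (c.proj Q' (c.incl L 0)))} := by
    rintro _ ⟨x, rfl⟩
    change c.map Q' π' L' (c.map Q π L x) = _
    rw [map_apply, map_apply, hconst]
  have := Set.ncard_le_ncard this
  rw [trRank] at h
  simp [h] at this

end Coordinates

/-! ### Orientations preserved or reversed by a primitive group -/

/-- The preserving elements form a normal subgroup, because a product of two reversing elements
preserves. If it acted trivially, the elements moving x to y and x to z would both be reversing, so
they would differ by an element acting trivially, which forces y = z. The third point z is
essential: on two points the preserving subgroup can be trivial. -/
theorem exists_pretransitive_subgroup_preserving {K α : Type*} [Group K] [MulAction K α]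
    [MulAction.IsPreprimitive K α] {D : α → α → Prop} (hD : ∀ x y, D x y → ¬ D y x)
    (hK : ∀ g : K, (∀ x y, D x y → D (g • x) (g • y)) ∨ (∀ x y, D x y → D (g • y) (g • x)))
    {x y z : α} (hxy : D x y) (hzy : z ≠ y) (hzx : z ≠ x) :
    ∃ H : Subgroup K, MulAction.IsPretransitive H α ∧
      ∀ g ∈ H, ∀ x y, D x y → D (g • x) (g • y) := by
  let H : Subgroup K :=
    { carrier := {g | ∀ x y, D x y → D (g • x) (g • y)}
      mul_mem' := fun {g h} hg hh x y hxy => by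
        simpa [mul_smul] using hg _ _ (hh _ _ hxy)
      one_mem' := fun x y hxy => by simpa using hxy
      inv_mem' := fun {g} hg x y hxy => by
        rcases hK g⁻¹ with h | h
        · exact h x y hxy
        · exact absurd (by simpa using h _ _ (hg _ _ hxy)) (hD _ _ hxy) }
  have hflip : ∀ g, g ∉ H → ∀ x y, D x y → D (g • y) (g • x) :=
    fun g hg => (hK g).resolve_left hg
  have hnormal : H.Normal := by
    refine ⟨fun n hn g => ?_⟩
    by_cases hg : g ∈ H
    · exact H.mul_mem (H.mul_mem hg hn) (H.inv_mem hg)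
    · have hg' : g⁻¹ ∉ H := fun h => hg (inv_inv g ▸ H.inv_mem h)
      intro x y hxy
      simpa [mul_smul] using hflip g hg _ _ (hn _ _ (hflip _ hg' _ _ hxy))
  refine ⟨H, ?_, fun g hg => hg⟩
  refine MulAction.IsQuasiPreprimitive.isPretransitive_of_normal (G := K) fun hfix => ?_
  have hfix' : ∀ g ∈ H, ∀ w : α, g • w = w := fun g hg w =>
    (Set.ext_iff.1 hfix w).2 trivial ⟨g, hg⟩
  obtain ⟨g, hg⟩ := MulAction.exists_smul_eq K x y
  obtain ⟨k, hk⟩ := MulAction.exists_smul_eq K x z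
  have hgH : g ∉ H := fun h => by
    have : x = y := (hfix' g h x).symm.trans hg
    subst this
    exact hD _ _ hxy hxy
  have hgH' : g⁻¹ ∉ H := fun h => hgH (inv_inv g ▸ H.inv_mem h)
  have hkH : k ∉ H := fun h => hzx (hk.symm.trans (hfix' k h x))
  have hgk : g⁻¹ * k ∈ H := fun x y hxy => by
    simpa [mul_smul] using hflip _ hgH' _ _ (hflip _ hkH _ _ hxy)
  have := hfix' _ hgk x
  rw [mul_smul, hk, inv_smul_eq_iff, hg] at this
  exact hzy this

/-- If no arc left B, every translate of (x, y) by the transitive preserving subgroup that starts in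
B would end in B. By counting, every translate ending in B would then start in B, but (x, y) itself
does not. -/
theorem exists_edge_leaving {K α : Type*} [Group K] [Finite K] [MulAction K α]
    [MulAction.IsPreprimitive K α] {D : α → α → Prop} (hD : ∀ x y, D x y → ¬ D y x)
    (hK : ∀ g : K, (∀ x y, D x y → D (g • x) (g • y)) ∨ (∀ x y, D x y → D (g • y) (g • x)))
    {x y z : α} (hxy : D x y) (hzy : z ≠ y) (hzx : z ≠ x) {B : Set α} (hx : x ∉ B)
    (hy : y ∈ B) : ∃ x' y', D x' y' ∧ x' ∈ B ∧ y' ∉ B := by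
  obtain ⟨H, hH, hHD⟩ := exists_pretransitive_subgroup_preserving hD hK hxy hzy hzx
  by_contra! hc
  refine hx ?_
  simpa using smul_mem_of_forall_smul_mem (K := H) (x := x) (y := y) (B := B)
    (fun g hg => hc _ _ (hHD g g.2 _ _ hxy) hg) 1 (by simpa using hy)

/-! ### Ranks and the elements of `genDiff G t` -/

theorem trRank_mul_le_left {Ω : Type*} [Finite Ω] (f g : Function.End Ω) :
    trRank (f * g) ≤ trRank f :=
  Set.ncard_le_ncard (Set.range_comp_subset_range (g : Ω → Ω) (f : Ω → Ω))

theorem trRank_mul_le_right {Ω : Type*} [Finite Ω] (f g : Function.End Ω) :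
    trRank (f * g) ≤ trRank g := by
  have : Set.range (f * g : Function.End Ω) = (f : Ω → Ω) '' Set.range (g : Ω → Ω) :=
    Set.range_comp (f : Ω → Ω) (g : Ω → Ω)
  rw [trRank, this]
  exact Set.ncard_image_le

theorem mem_permMaps_iff {Ω : Type*} {G : Subgroup (Equiv.Perm Ω)} {f : Function.End Ω} :
    f ∈ permMaps G ↔ ∃ g : G, f = MulAction.toEndHom g :=
  ⟨fun ⟨g, hg, h⟩ => ⟨⟨g, hg⟩, h⟩, fun ⟨g, h⟩ => ⟨g, g.2, h⟩⟩

theorem trRank_toEndHom {Ω : Type*} {G : Subgroup (Equiv.Perm Ω)} (g : G) :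
    trRank (MulAction.toEndHom g : Function.End Ω) = Nat.card Ω := by
  have h : Function.Surjective ((MulAction.toEndHom g : Function.End Ω) : Ω → Ω) :=
    MulAction.surjective g
  rw [trRank, h.range_eq, Set.ncard_univ]

theorem toEndHom_mul_mul_cancel {Ω : Type*} {G : Subgroup (Equiv.Perm Ω)} (g h : G)
    (f : Function.End Ω) :
    MulAction.toEndHom g * (MulAction.toEndHom g⁻¹ * f * MulAction.toEndHom h⁻¹) *
      MulAction.toEndHom h = f := by
  funext x
  change g • g⁻¹ • (f : Ω → Ω) (h⁻¹ • h • x) = (f : Ω → Ω) x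
  rw [smul_inv_smul, inv_smul_smul]

theorem three_le_card {Ω : Type*} [Finite Ω] {t : Function.End Ω} (ht : trRank t = 2)
    (hsing : ¬ Function.Bijective (t : Ω → Ω)) : 3 ≤ Nat.card Ω := by
  have hle : trRank t ≤ Nat.card Ω := by
    rw [← Set.ncard_univ]
    exact Set.ncard_le_ncard (Set.subset_univ _)
  by_contra! hlt
  refine hsing (Finite.surjective_iff_bijective.1 (Set.range_eq_univ.1 ?_))
  refine Set.eq_of_subset_of_ncard_le (Set.subset_univ _) ?_
  rw [Set.ncard_univ, show (Set.range (t : Ω → Ω)).ncard = 2 from ht]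
  omega

theorem mem_genDiff_of_trRank_le {Ω : Type*} [Finite Ω] {G : Subgroup (Equiv.Perm Ω)}
    {t f : Function.End Ω} (h3 : 3 ≤ Nat.card Ω)
    (hf : f ∈ Subsemigroup.closure (permMaps G ∪ {t})) (hr : trRank f ≤ 2) :
    f ∈ genDiff G t := by
  refine ⟨hf, fun h => ?_⟩
  obtain ⟨g, rfl⟩ := mem_permMaps_iff.1 h
  rw [trRank_toEndHom] at hr
  omega

namespace Coordinates

variable {Ω : Type*} {G : Subgroup (Equiv.Perm Ω)} {t : Function.End Ω} (c : Coordinates G t)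

theorem exists_toEndHom_mul_map (g : G) (Q : MulAction.orbit G (kerPartition t))
    (π : Equiv.Perm (Fin 2)) (L : MulAction.orbit G (Set.range (t : Ω → Ω))) :
    ∃ π', MulAction.toEndHom g * c.map Q π L = c.map Q π' (g • L) := by
  refine c.exists_eq_map ?_ ?_
  · rw [← c.kerPartition_map Q π L, kerPartition, kerPartition]
    congr 1
    ext x y
    exact (MulAction.injective g).eq_iff
  · rw [MulAction.orbit.coe_smul, ← c.range_map Q π L]
    exact (smul_range_eq G g _).symm

theorem exists_map_mul_toEndHom (g : G) (Q : MulAction.orbit G (kerPartition t))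
    (π : Equiv.Perm (Fin 2)) (L : MulAction.orbit G (Set.range (t : Ω → Ω))) :
    ∃ π', c.map Q π L * MulAction.toEndHom g⁻¹ = c.map (g • Q) π' L := by
  refine c.exists_eq_map ?_ ?_
  · rw [MulAction.orbit.coe_smul, ← c.kerPartition_map Q π L]
    exact (smul_classes_ker G g (c.map Q π L : Ω → Ω)).symm
  · rw [← c.range_map Q π L]
    exact (MulAction.surjective g⁻¹).range_comp (c.map Q π L : Ω → Ω)

theorem exists_eq_self : ∃ π, t = c.map ⟨_, MulAction.mem_orbit_self _⟩ π
    ⟨_, MulAction.mem_orbit_self _⟩ :=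
  c.exists_eq_map rfl rfl

theorem exists_idempotent_map {Q : MulAction.orbit G (kerPartition t)}
    {L : MulAction.orbit G (Set.range (t : Ω → Ω))} (h : c.matrix L Q ≠ 0) :
    ∃ π, IsIdempotentElem (c.map Q π L) := by
  refine ⟨(WithZero.unzero h)⁻¹, ?_⟩
  rw [IsIdempotentElem, c.map_mul_map h, inv_mul_cancel, one_mul]

theorem coe_eq_pair (π : Equiv.Perm (Fin 2)) (L : MulAction.orbit G (Set.range (t : Ω → Ω))) :
    L.1 = {c.incl L (π 0), c.incl L (π 1)} := by
  rw [← c.range_incl L, ← π.surjective.range_comp (c.incl L)]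
  ext x
  simp only [Set.mem_range, Function.comp_apply, Fin.exists_fin_two, Set.mem_insert_iff,
    Set.mem_singleton_iff]
  exact or_congr eq_comm eq_comm

variable [Finite Ω]

/-- Multiplying by a permutation moves the kernel or the image within its orbit, and a rank 2
product of rank 2 maps keeps the kernel of the factor applied first and the image of the one applied
last. -/
theorem mem_closure_cases (ht : trRank t = 2) {f : Function.End Ω}
    (hf : f ∈ Subsemigroup.closure (permMaps G ∪ {t})) :
    f ∈ permMaps G ∨ (trRank f ≤ 2 ∧ (trRank f = 2 → ∃ Q π L, f = c.map Q π L)) := by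
  induction hf using Subsemigroup.closure_induction with
  | mem x hx =>
    rcases hx with hx | rfl
    · exact Or.inl hx
    · exact Or.inr ⟨ht.le, fun _ => ⟨_, c.exists_eq_self.choose, _, c.exists_eq_self.choose_spec⟩⟩
  | mul x y _ _ hx hy =>
    have hl := trRank_mul_le_left x y
    have hr := trRank_mul_le_right x y
    rcases hx with hx | ⟨hx, hx'⟩ <;> rcases hy with hy | ⟨hy, hy'⟩
    · obtain ⟨g, rfl⟩ := mem_permMaps_iff.1 hx
      obtain ⟨h, rfl⟩ := mem_permMaps_iff.1 hy
      exact Or.inl (mem_permMaps_iff.2 ⟨g * h, (map_mul _ _ _).symm⟩)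
    · refine Or.inr ⟨hr.trans hy, fun h => ?_⟩
      obtain ⟨Q, π, L, rfl⟩ := hy' (by omega)
      obtain ⟨g, rfl⟩ := mem_permMaps_iff.1 hx
      obtain ⟨π', h'⟩ := c.exists_toEndHom_mul_map g Q π L
      exact ⟨_, _, _, h'⟩
    · refine Or.inr ⟨hl.trans hx, fun h => ?_⟩
      obtain ⟨Q, π, L, rfl⟩ := hx' (by omega)
      obtain ⟨g, rfl⟩ := mem_permMaps_iff.1 hy
      obtain ⟨π', h'⟩ := c.exists_map_mul_toEndHom g⁻¹ Q π L
      rw [inv_inv] at h'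
      exact ⟨_, _, _, h'⟩
    · refine Or.inr ⟨hl.trans hx, fun h => ?_⟩
      obtain ⟨Q, π, L, rfl⟩ := hx' (by omega)
      obtain ⟨Q', π', L', rfl⟩ := hy' (by omega)
      exact ⟨_, _, _, c.map_mul_map (c.matrix_ne_zero_of_trRank h)⟩

theorem trRank_le_of_mem_genDiff (c : Coordinates G t) (ht : trRank t = 2) {f : Function.End Ω}
    (hf : f ∈ genDiff G t) : trRank f ≤ 2 :=
  ((c.mem_closure_cases ht hf.1).resolve_left hf.2).1

theorem exists_eq_map_of_mem_genDiff (ht : trRank t = 2) {f : Function.End Ω}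
    (hf : f ∈ genDiff G t) (h2 : trRank f = 2) : ∃ Q π L, f = c.map Q π L :=
  ((c.mem_closure_cases ht hf.1).resolve_left hf.2).2 h2

theorem mul_mem_genDiff (c : Coordinates G t) (ht : trRank t = 2) (h3 : 3 ≤ Nat.card Ω) {f g : Function.End Ω}
    (hf : f ∈ genDiff G t) (hg : g ∈ genDiff G t) : f * g ∈ genDiff G t :=
  mem_genDiff_of_trRank_le h3 (mul_mem hf.1 hg.1)
    ((trRank_mul_le_left f g).trans (c.trRank_le_of_mem_genDiff ht hf))

theorem toEndHom_mul_mem_genDiff (c : Coordinates G t) (ht : trRank t = 2) (h3 : 3 ≤ Nat.card Ω) (g h : G)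
    {f : Function.End Ω} (hf : f ∈ genDiff G t) :
    MulAction.toEndHom g * f * MulAction.toEndHom h ∈ genDiff G t := by
  have hmem : ∀ k : G, MulAction.toEndHom k ∈ Subsemigroup.closure (permMaps G ∪ {t}) :=
    fun k => Subsemigroup.subset_closure (Or.inl (mem_permMaps_iff.2 ⟨k, rfl⟩))
  exact mem_genDiff_of_trRank_le h3 (mul_mem (mul_mem (hmem g) hf.1) (hmem h))
    ((trRank_mul_le_left _ _).trans ((trRank_mul_le_right _ _).trans
      (c.trRank_le_of_mem_genDiff ht hf)))

theorem closure_idempotents_subset (ht : trRank t = 2) (h3 : 3 ≤ Nat.card Ω)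
    {f : Function.End Ω}
    (hf : f ∈ Subsemigroup.closure {e | e ∈ genDiff G t ∧ IsIdempotentElem e})
    (c : Coordinates G t) : f ∈ genDiff G t := by
  induction hf using Subsemigroup.closure_induction with
  | mem x hx => exact hx.1
  | mul x y _ _ hx hy => exact c.mul_mem_genDiff ht h3 hx hy

theorem conj_mem_closure_idempotents (ht : trRank t = 2) (h3 : 3 ≤ Nat.card Ω)
    (c : Coordinates G t) (g : G) {f : Function.End Ω}
    (hf : f ∈ Subsemigroup.closure {e | e ∈ genDiff G t ∧ IsIdempotentElem e}) :
    MulAction.toEndHom g * f * MulAction.toEndHom g⁻¹ ∈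
      Subsemigroup.closure {e | e ∈ genDiff G t ∧ IsIdempotentElem e} := by
  have hmul : ∀ x y : Function.End Ω,
      MulAction.toEndHom g * (x * y) * MulAction.toEndHom g⁻¹ =
        (MulAction.toEndHom g * x * MulAction.toEndHom g⁻¹) *
          (MulAction.toEndHom g * y * MulAction.toEndHom g⁻¹) := by
    intro x y
    have h1 : (MulAction.toEndHom g⁻¹ * MulAction.toEndHom g : Function.End Ω) = 1 := by
      rw [← map_mul, inv_mul_cancel, map_one]
    simp only [mul_assoc]
    rw [← mul_assoc (MulAction.toEndHom g⁻¹) (MulAction.toEndHom g), h1, one_mul]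
  induction hf using Subsemigroup.closure_induction with
  | mem x hx =>
    refine Subsemigroup.subset_closure ⟨c.toEndHom_mul_mem_genDiff ht h3 _ _ hx.1, ?_⟩
    rw [IsIdempotentElem, ← hmul, hx.2.eq]
  | mul x y _ _ hx hy =>
    rw [hmul]
    exact mul_mem hx hy

/-- A rank 2 idempotent is an edge, since its square has rank 2. In a product, the image of the
factor applied first is a transversal for the kernel of the other, and this edge joins the two
paths. -/
theorem reachable_of_map_mem (ht : trRank t = 2) (h3 : 3 ≤ Nat.card Ω) {f : Function.End Ω}
    (hf : f ∈ Subsemigroup.closure {e | e ∈ genDiff G t ∧ IsIdempotentElem e}) :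
    ∀ Q π L, f = c.map Q π L →
      (houghtonGraph G (kerPartition t) (Set.range (t : Ω → Ω))).Reachable (.inl Q) (.inr L) := by
  have hadj : ∀ Q L, c.matrix L Q ≠ 0 →
      (houghtonGraph G (kerPartition t) (Set.range (t : Ω → Ω))).Adj (.inl Q) (.inr L) :=
    fun Q L h => c.matrix_ne_zero_iff.1 h
  induction hf using Subsemigroup.closure_induction with
  | mem x hx =>
    rintro Q π L rfl
    refine (hadj Q L (c.matrix_ne_zero_of_trRank (π := π) (π' := π) (Q := Q) (L' := L)
      ?_)).reachable
    rw [hx.2.eq, c.trRank_map]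
  | mul x y hx hy ihx ihy =>
    intro Q π L h
    have h2 : trRank (x * y) = 2 := h ▸ c.trRank_map Q π L
    have hxS := closure_idempotents_subset ht h3 hx c
    have hyS := closure_idempotents_subset ht h3 hy c
    have hx2 := c.trRank_le_of_mem_genDiff ht hxS
    have hy2 := c.trRank_le_of_mem_genDiff ht hyS
    have hl := trRank_mul_le_left x y
    have hr := trRank_mul_le_right x y
    obtain ⟨Q₂, π₂, L₂, rfl⟩ := c.exists_eq_map_of_mem_genDiff ht hxS (by omega)
    obtain ⟨Q₁, π₁, L₁, rfl⟩ := c.exists_eq_map_of_mem_genDiff ht hyS (by omega)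
    have hne := c.matrix_ne_zero_of_trRank h2
    rw [c.map_mul_map hne] at h
    obtain ⟨rfl, -, rfl⟩ := c.map_inj.1 h
    exact ((ihy _ _ _ rfl).trans (hadj _ _ hne).symm.reachable).trans (ihx _ _ _ rfl)

/-! ### Consequences of primitivity: regularity and the Rees matrix representation -/

variable [MulAction.IsPreprimitive G Ω]

theorem exists_smul_proj (Q : MulAction.orbit G (kerPartition t))
    (L : MulAction.orbit G (Set.range (t : Ω → Ω))) (σ : Equiv.Perm (Fin 2)) :
    ∃ g : G, ∀ a, c.proj Q (g • c.incl L a) = σ a := by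
  have hne : c.incl L 0 ≠ c.incl L 1 := fun h => absurd (c.incl_injective L h) (by decide)
  obtain ⟨x0, hx0⟩ := c.proj_surjective Q (σ 0)
  obtain ⟨x1, hx1⟩ := c.proj_surjective Q (σ 1)
  have h01 : σ 0 ≠ σ 1 := fun h => absurd (σ.injective h) (by decide)
  obtain ⟨g, hg0, hg1⟩ := MulAction.IsPreprimitive.exists_smul_mem_smul_notMem (K := G) hne
    (B := {x | c.proj Q x = σ 0}) ⟨x0, hx0⟩
    (fun h => h01 (((Set.ext_iff.1 h x1).2 trivial).symm.trans hx1))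
  refine ⟨g, fun a => ?_⟩
  fin_cases a
  · exact hg0
  · exact (Fin.ne_iff_eq_of_ne h01 _).1 hg1

theorem exists_smul_isTransversalFor (c : Coordinates G t)
    (Q : MulAction.orbit G (kerPartition t))
    (L : MulAction.orbit G (Set.range (t : Ω → Ω))) :
    ∃ g : G, IsTransversalFor (g • L).1 Q.1 := by
  obtain ⟨g, hg⟩ := c.exists_smul_proj Q L 1
  refine ⟨g, ?_⟩
  rw [MulAction.orbit.coe_smul, ← c.range_incl L, ← c.classes_proj Q, smul_range_eq]
  rintro _ ⟨x, rfl⟩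
  refine ⟨_, ⟨⟨c.proj Q x, rfl⟩, hg _⟩, ?_⟩
  rintro _ ⟨⟨b, rfl⟩, hb⟩
  rw [← (hg b).symm.trans hb]
  rfl

theorem _root_.isTransversalFor_smul_iff {Ω : Type*} {G : Subgroup (Equiv.Perm Ω)} (g : G)
    {S : Set Ω} {P : Set (Set Ω)} :
    IsTransversalFor (g • S) (g • P) ↔ IsTransversalFor S P := by
  constructor
  · intro h A hA
    obtain ⟨x, ⟨hx, hx'⟩, hu⟩ := h (g • A) (Set.smul_mem_smul_set hA)
    refine ⟨g⁻¹ • x, ⟨Set.mem_smul_set_iff_inv_smul_mem.1 hx,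
      Set.mem_smul_set_iff_inv_smul_mem.1 hx'⟩, fun y hy => ?_⟩
    rw [eq_inv_smul_iff]
    exact hu _ ⟨Set.smul_mem_smul_set hy.1, Set.smul_mem_smul_set hy.2⟩
  · rintro h _ ⟨A, hA, rfl⟩
    obtain ⟨x, ⟨hx, hx'⟩, hu⟩ := h A hA
    refine ⟨g • x, ⟨Set.smul_mem_smul_set hx, Set.smul_mem_smul_set hx'⟩, ?_⟩
    rintro _ ⟨⟨y, hy, rfl⟩, hy'⟩
    rw [← hu y ⟨hy, (Set.smul_mem_smul_set_iff).1 hy'⟩]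

theorem isRegularMatrix_matrix : IsRegularMatrix c.matrix := by
  constructor
  · intro L
    obtain ⟨g, hg⟩ := c.exists_smul_isTransversalFor ⟨_, MulAction.mem_orbit_self _⟩ L
    refine ⟨g⁻¹ • ⟨_, MulAction.mem_orbit_self _⟩, c.matrix_ne_zero_iff.2 ?_⟩
    rw [← isTransversalFor_smul_iff g]
    simpa [MulAction.orbit.coe_smul] using hg
  · intro Q
    obtain ⟨g, hg⟩ := c.exists_smul_isTransversalFor Q ⟨_, MulAction.mem_orbit_self _⟩
    exact ⟨_, c.matrix_ne_zero_iff.2 hg⟩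

theorem map_mem_genDiff (ht : trRank t = 2) (h3 : 3 ≤ Nat.card Ω)
    (Q : MulAction.orbit G (kerPartition t)) (π : Equiv.Perm (Fin 2))
    (L : MulAction.orbit G (Set.range (t : Ω → Ω))) : c.map Q π L ∈ genDiff G t := by
  have htS : t ∈ genDiff G t :=
    mem_genDiff_of_trRank_le h3 (Subsemigroup.subset_closure (Or.inr rfl)) ht.le
  have hbase : ∀ π, c.map ⟨_, MulAction.mem_orbit_self _⟩ π ⟨_, MulAction.mem_orbit_self _⟩ ∈
      genDiff G t := by
    intro π
    obtain ⟨τ, hτ⟩ := c.exists_eq_self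
    -- The label of tgt is τστ, where σ is the label induced by g; this σ makes it equal to π.
    obtain ⟨g, hg⟩ := c.exists_smul_proj ⟨_, MulAction.mem_orbit_self _⟩
      ⟨_, MulAction.mem_orbit_self _⟩ (τ⁻¹ * π * τ⁻¹)
    have h := c.mul_mem_genDiff ht h3 (c.toEndHom_mul_mem_genDiff ht h3 1 g htS) htS
    convert h using 1
    rw [map_one, one_mul]
    funext x
    have happ : ∀ x, (t : Ω → Ω) x = c.map _ τ _ x := congrFun hτ
    change _ = (t : Ω → Ω) (g • (t : Ω → Ω) x)
    rw [happ, happ, map_apply, map_apply, map_apply, hg]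
    simp
  obtain ⟨_, g, rfl⟩ := Q
  obtain ⟨_, h, rfl⟩ := L
  obtain ⟨π₁, h₁⟩ := c.exists_toEndHom_mul_map h⁻¹ ⟨_, g, rfl⟩ π ⟨_, h, rfl⟩
  obtain ⟨π₂, h₂⟩ := c.exists_map_mul_toEndHom g⁻¹ ⟨_, g, rfl⟩ π₁ (h⁻¹ • ⟨_, h, rfl⟩)
  rw [← toEndHom_mul_mul_cancel h g⁻¹ (c.map _ π _), h₁, h₂]
  refine c.toEndHom_mul_mem_genDiff ht h3 _ _ ?_
  convert hbase π₂ using 2 <;> exact Subtype.ext (inv_smul_smul _ _)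

theorem nonempty_mulEquiv (ht : trRank t = 2) (h3 : 3 ≤ Nat.card Ω) :
    Nonempty (RankFactor (genDiff G t) 2 ≃* ReesMatrixSemigroup c.matrix) := by
  let φ : ReesMatrixSemigroup c.matrix → RankFactor (genDiff G t) 2
    | .zero => .zero
    | .elem Q π L => .elem (c.map Q π L) ⟨c.map_mem_genDiff ht h3 Q π L, c.trRank_map Q π L⟩
  have hφ : Function.Bijective φ := by
    constructor
    · rintro (_ | ⟨Q, π, L⟩) (_ | ⟨Q', π', L'⟩) h
      · rfl
      · exact absurd h (by simp [φ])
      · exact absurd h (by simp [φ])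
      · obtain ⟨rfl, rfl, rfl⟩ := c.map_inj.1 (RankFactor.elem.inj h)
        rfl
    · rintro (_ | ⟨f, hf, hf2⟩)
      · exact ⟨.zero, rfl⟩
      · obtain ⟨Q, π, L, rfl⟩ := c.exists_eq_map_of_mem_genDiff ht hf hf2
        exact ⟨.elem Q π L, rfl⟩
  refine ⟨(MulEquiv.ofBijective (⟨φ, ?_⟩ : ReesMatrixSemigroup c.matrix →ₙ*
    RankFactor (genDiff G t) 2) hφ).symm⟩
  rintro (_ | ⟨Q, π, L⟩) (_ | ⟨Q', π', L'⟩)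
  · rfl
  · rfl
  · rfl
  · by_cases h : c.matrix L Q' = 0
    · rw [ReesMatrixSemigroup.elem_mul_elem_eq_zero _ _ _ _ _ _ h]
      have hno : ¬ (c.map Q' π' L' * c.map Q π L ∈ genDiff G t ∧
          trRank (c.map Q' π' L' * c.map Q π L) = 2) :=
        fun hr => c.matrix_ne_zero_of_trRank hr.2 h
      refine Eq.trans ?_ (dif_neg hno).symm
      rfl
    · rw [ReesMatrixSemigroup.elem_mul_elem _ _ _ _ _ _ h]
      -- Maps compose left to right in `RankFactor` but labels multiply right to left; commutativity
      -- of S_2 reconciles the two orders.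
      have hmul : c.map Q' π' L' * c.map Q π L = c.map Q (π * WithZero.unzero h * π') L' := by
        rw [c.map_mul_map h, permFinTwo_mul_comm _ π, permFinTwo_mul_comm π', mul_assoc]
      have hmem : c.map Q' π' L' * c.map Q π L ∈ genDiff G t ∧
          trRank (c.map Q' π' L' * c.map Q π L) = 2 :=
        hmul ▸ ⟨c.map_mem_genDiff ht h3 _ _ _, c.trRank_map _ _ _⟩
      refine Eq.trans ?_ (dif_pos hmem).symm
      simp only [φ, hmul]

/-! ### Connectedness implies idempotent generation -/

/-- Multiplying on both sides by fixed maps of `E`, across non-zero matrix entries, is injective on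
labels. Two labels at one pair thus give two at any other, and S_2 has no more. -/
theorem forall_map_mem_of_two {E : Subsemigroup (Function.End Ω)}
    (hE : ∀ Q L, ∃ π, c.map Q π L ∈ E) {Q : MulAction.orbit G (kerPartition t)}
    {π π' : Equiv.Perm (Fin 2)} {L : MulAction.orbit G (Set.range (t : Ω → Ω))}
    (h : c.map Q π L ∈ E) (h' : c.map Q π' L ∈ E) (hne : π ≠ π') (Q₀ π₀ L₀) :
    c.map Q₀ π₀ L₀ ∈ E := by
  obtain ⟨L₁, h₁⟩ := c.isRegularMatrix_matrix.2 Q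
  obtain ⟨Q₁, h₂⟩ := c.isRegularMatrix_matrix.1 L
  obtain ⟨α, hα⟩ := hE Q₀ L₁
  obtain ⟨β, hβ⟩ := hE Q₁ L₀
  have key : ∀ τ, c.map Q τ L ∈ E →
      c.map Q₀ (β * WithZero.unzero h₂ * (τ * WithZero.unzero h₁ * α)) L₀ ∈ E := by
    intro τ hτ
    rw [← c.map_mul_map h₂, ← c.map_mul_map h₁]
    exact mul_mem hβ (mul_mem hτ hα)
  have hne' : β * WithZero.unzero h₂ * (π * WithZero.unzero h₁ * α) ≠
      β * WithZero.unzero h₂ * (π' * WithZero.unzero h₁ * α) := by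
    simpa [mul_assoc] using hne
  rcases permFinTwo_eq_or_eq hne' π₀ with rfl | rfl
  · exact key _ h
  · exact key _ h'

/-- The oriented edges `(x, y)` such that some map in `E` with kernel `Q` sends the two classes of
`Q` to `x` and `y`. -/
def Edge (E : Subsemigroup (Function.End Ω)) (Q : MulAction.orbit G (kerPartition t))
    (x y : Ω) : Prop :=
  ∃ π L, c.map Q π L ∈ E ∧ x = c.incl L (π 0) ∧ y = c.incl L (π 1)

/-- Conjugation by g turns the kernel Q into g • Q; precomposing with a fixed map of `E` with kernel
Q and image a transversal for g • Q restores Q. The resulting relabelling `a` of the classes does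
not depend on the arc, so all arcs are treated alike. -/
theorem edge_smul_or_edge_smul {E : Subsemigroup (Function.End Ω)}
    (hconj : ∀ (g : G), ∀ f ∈ E, MulAction.toEndHom g * f * MulAction.toEndHom g⁻¹ ∈ E)
    (hE : ∀ Q L, ∃ π, c.map Q π L ∈ E) (Q : MulAction.orbit G (kerPartition t)) (g : G) :
    (∀ x y, c.Edge E Q x y → c.Edge E Q (g • x) (g • y)) ∨
      (∀ x y, c.Edge E Q x y → c.Edge E Q (g • y) (g • x)) := by
  obtain ⟨L₁, h₁⟩ := c.isRegularMatrix_matrix.2 (g • Q)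
  obtain ⟨π₁, hπ₁⟩ := hE Q L₁
  let a : Fin 2 → Fin 2 := fun i => c.proj Q (g⁻¹ • c.incl L₁ (π₁ i))
  have key : ∀ π L, c.map Q π L ∈ E →
      ∃ π₃, c.map Q π₃ (g • L) ∈ E ∧ ∀ i, c.incl (g • L) (π₃ i) = g • c.incl L (π (a i)) := by
    intro π L hπ
    obtain ⟨π₂, h₂⟩ := c.exists_toEndHom_mul_map g Q π L
    obtain ⟨π₃, h₃⟩ := c.exists_map_mul_toEndHom g Q π₂ (g • L)
    have hmem := mul_mem (hconj g _ hπ) hπ₁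
    have heq := hmem
    rw [h₂, h₃, c.map_mul_map h₁] at heq
    refine ⟨_, heq, fun i => ?_⟩
    obtain ⟨x, rfl⟩ := c.proj_surjective Q i
    have h := c.map_mul_map (Q := Q) (π := π₁) (π' := π₃) (L' := g • L) h₁
    rw [← h₃, ← h₂] at h
    exact (congrFun h x).symm
  have ha : ∀ π L, c.map Q π L ∈ E → a 0 ≠ a 1 := by
    intro π L hπ h01
    obtain ⟨π₃, -, h⟩ := key π L hπ
    have : π₃ 0 = π₃ 1 := c.incl_injective _ (by rw [h, h, h01])
    exact absurd (π₃.injective this) (by decide)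
  by_cases h0 : a 0 = 0
  · left
    rintro _ _ ⟨π, L, hπ, rfl, rfl⟩
    have h1 : a 1 = 1 := by have := ha π L hπ; omega
    obtain ⟨π₃, hm, h⟩ := key π L hπ
    refine ⟨π₃, _, hm, ?_, ?_⟩
    · rw [h, h0]
    · rw [h, h1]
  · right
    rintro _ _ ⟨π, L, hπ, rfl, rfl⟩
    have h0' : a 0 = 1 := by omega
    have h1 : a 1 = 0 := by have := ha π L hπ; omega
    obtain ⟨π₃, hm, h⟩ := key π L hπ
    refine ⟨π₃, _, hm, ?_, ?_⟩
    · rw [h, h0']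
    · rw [h, h1]

theorem forall_map_mem (h3 : 3 ≤ Nat.card Ω) {E : Subsemigroup (Function.End Ω)}
    (hconj : ∀ (g : G), ∀ f ∈ E, MulAction.toEndHom g * f * MulAction.toEndHom g⁻¹ ∈ E)
    (hE : ∀ Q L, ∃ π, c.map Q π L ∈ E) (Q₀ π₀ L₀) : c.map Q₀ π₀ L₀ ∈ E := by
  by_contra hnot
  have huniq : ∀ {Q π π' L}, c.map Q π L ∈ E → c.map Q π' L ∈ E → π = π' := by
    intro Q π π' L h h'
    by_contra hne
    exact hnot (c.forall_map_mem_of_two hE h h' hne _ _ _)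
  have hasymm : ∀ x y, c.Edge E Q₀ x y → ¬ c.Edge E Q₀ y x := by
    rintro _ _ ⟨π, L, h, rfl, rfl⟩ ⟨π', L', h', h1, h0⟩
    have hL : L = L' := Subtype.ext (by
      rw [c.coe_eq_pair π L, c.coe_eq_pair π' L', ← h0, ← h1, Set.pair_comm])
    subst hL
    obtain rfl := huniq h h'
    exact absurd (π.injective (c.incl_injective L h0)) (by decide)
  obtain ⟨L, hL⟩ := c.isRegularMatrix_matrix.2 Q₀
  obtain ⟨π, hπ⟩ := hE Q₀ L
  obtain ⟨β, hβ⟩ := hE Q₀ L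
  -- A third point, needed for the transitivity of the orientation-preserving subgroup.
  obtain ⟨z, hz⟩ : ∃ z, z ∉ ({c.incl L (π 0), c.incl L (π 1)} : Set Ω) := by
    by_contra! hall
    have := (Set.ncard_univ Ω).symm.trans_le ((Set.ncard_le_ncard fun x _ => hall x).trans
      (Set.ncard_insert_le _ _))
    rw [Set.ncard_singleton] at this
    omega
  simp only [Set.mem_insert_iff, Set.mem_singleton_iff, not_or] at hz
  -- The arc on L enters the class of Q₀ containing its head; take an arc leaving that class.
  obtain ⟨_, _, ⟨π', L', hπ', rfl, rfl⟩, hB, hB'⟩ :=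
    exists_edge_leaving hasymm (c.edge_smul_or_edge_smul hconj hE Q₀) ⟨π, L, hπ, rfl, rfl⟩
      hz.2 hz.1 (B := {x | c.proj Q₀ x = c.proj Q₀ (c.incl L (π 1))})
      (fun h => by
        rw [Set.mem_ofPred_eq, ← c.unzero_matrix_apply hL, ← c.unzero_matrix_apply hL] at h
        exact absurd (π.injective (Equiv.injective _ h)) (by decide)) rfl
  rw [Set.mem_ofPred_eq] at hB hB'
  rw [← hB] at hB'
  have hL' : c.matrix L' Q₀ ≠ 0 := by
    rw [c.matrix_ne_zero_iff, c.isTransversalFor_iff, ← Finite.injective_iff_bijective]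
    refine (π'.injective_comp _).1 fun i j hij => ?_
    fin_cases i <;> fin_cases j
    · rfl
    · exact absurd hij.symm hB'
    · exact absurd hij hB'
    · rfl
  -- Following both maps by the same map `β` gives two elements with kernel Q₀ and image L. The arcs
  -- cross Q₀ in opposite directions, so the labels differ at 0.
  have heq := huniq (c.map_mul_map hL ▸ mul_mem hβ hπ) (c.map_mul_map hL' ▸ mul_mem hβ hπ')
  have h0 := DFunLike.congr_fun heq 0
  simp only [Equiv.Perm.mul_apply, EmbeddingLike.apply_eq_iff_eq, unzero_matrix_apply, hB] at h0
  rw [← c.unzero_matrix_apply hL, ← c.unzero_matrix_apply hL] at h0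
  exact absurd (π.injective (Equiv.injective _ h0)) (by decide)

/-- A map with image L can be followed by an idempotent whose kernel is adjacent to L. At a
partition vertex the invariant covers all its neighbouring sets, so that the next step of the path
is already available. -/
theorem exists_map_mem_of_reachable (ht : trRank t = 2) (h3 : 3 ≤ Nat.card Ω)
    {Q : MulAction.orbit G (kerPartition t)}
    {v : MulAction.orbit G (kerPartition t) ⊕ MulAction.orbit G (Set.range (t : Ω → Ω))}
    (h : (houghtonGraph G (kerPartition t) (Set.range (t : Ω → Ω))).Reachable (.inl Q) v) :
    v.elim
      (fun Q' => ∀ L, c.matrix L Q' ≠ 0 → ∃ π, c.map Q π L ∈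
        Subsemigroup.closure {e | e ∈ genDiff G t ∧ IsIdempotentElem e})
      (fun L => ∃ π, c.map Q π L ∈
        Subsemigroup.closure {e | e ∈ genDiff G t ∧ IsIdempotentElem e}) := by
  have hidem : ∀ Q L, c.matrix L Q ≠ 0 → ∃ π, c.map Q π L ∈
      Subsemigroup.closure {e | e ∈ genDiff G t ∧ IsIdempotentElem e} := by
    intro Q L h
    obtain ⟨π, hπ⟩ := c.exists_idempotent_map h
    exact ⟨π, Subsemigroup.subset_closure ⟨c.map_mem_genDiff ht h3 _ _ _, hπ⟩⟩
  rw [SimpleGraph.reachable_iff_reflTransGen] at h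
  induction h with
  | refl => exact fun L h => hidem Q L h
  | @tail v w _ hadj ih =>
    rcases v with Q' | L <;> rcases w with Q'' | L'
    · exact hadj.elim
    · exact ih L' (c.matrix_ne_zero_iff.2 hadj)
    · intro L'' h''
      obtain ⟨π, hπ⟩ := ih
      obtain ⟨π', hπ'⟩ := hidem Q'' L'' h''
      exact ⟨_, c.map_mul_map (c.matrix_ne_zero_iff.2 hadj) ▸ mul_mem hπ' hπ⟩
    · exact hadj.elim

theorem isIdempotentGenerated_iff (c : Coordinates G t) (ht : trRank t = 2) (h3 : 3 ≤ Nat.card Ω) :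
    IsIdempotentGenerated (genDiff G t) ↔
      (houghtonGraph G (kerPartition t) (Set.range (t : Ω → Ω))).Connected := by
  have hclosure : ∀ Q L, (∃ π, c.map Q π L ∈
      Subsemigroup.closure {e | e ∈ genDiff G t ∧ IsIdempotentElem e}) →
      (houghtonGraph G (kerPartition t) (Set.range (t : Ω → Ω))).Reachable (.inl Q) (.inr L) :=
    fun Q L ⟨π, hπ⟩ => c.reachable_of_map_mem ht h3 hπ Q π L rfl
  constructor
  · intro h
    have hreach : ∀ Q L, (houghtonGraph G (kerPartition t)
        (Set.range (t : Ω → Ω))).Reachable (.inl Q) (.inr L) := by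
      intro Q L
      refine hclosure Q L ⟨1, ?_⟩
      have := c.map_mem_genDiff ht h3 Q 1 L
      rw [h] at this
      exact this
    let Q₀ : MulAction.orbit G (kerPartition t) := ⟨_, MulAction.mem_orbit_self _⟩
    let L₀ : MulAction.orbit G (Set.range (t : Ω → Ω)) := ⟨_, MulAction.mem_orbit_self _⟩
    have hbase : ∀ v, (houghtonGraph G (kerPartition t)
        (Set.range (t : Ω → Ω))).Reachable (.inl Q₀) v := by
      rintro (Q | L)
      · exact (hreach Q₀ L₀).trans (hreach Q L₀).symm
      · exact hreach Q₀ L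
    have : Nonempty (MulAction.orbit G (kerPartition t) ⊕
      MulAction.orbit G (Set.range (t : Ω → Ω))) := ⟨.inl Q₀⟩
    exact ⟨fun v w => (hbase v).symm.trans (hbase w)⟩
  · intro h
    refine Set.Subset.antisymm (fun f hf => ?_) fun f hf => closure_idempotents_subset ht h3 hf c
    by_cases h2 : trRank f = 2
    · obtain ⟨Q, π, L, rfl⟩ := c.exists_eq_map_of_mem_genDiff ht hf h2
      exact c.forall_map_mem h3 (fun g f hf => conj_mem_closure_idempotents ht h3 c g hf)
        (fun Q L => c.exists_map_mem_of_reachable ht h3 (h.preconnected (.inl Q) (.inr L))) Q π L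
    -- The remaining elements have rank at most 1, so they are idempotent.
    · refine Subsemigroup.subset_closure ⟨hf, funext fun x => ?_⟩
      have hle : (Set.range (f : Ω → Ω)).ncard ≤ 1 := by
        have := c.trRank_le_of_mem_genDiff ht hf
        rw [trRank] at this h2
        omega
      exact (Set.ncard_le_one (Set.toFinite _)).1 hle _ (Set.mem_range_self _) _
        (Set.mem_range_self _)

end Coordinates

/-! ### Connectedness of Rees matrix semigroups as an isomorphism invariant -/

/-- The graph on the idempotents other than `0`, two of them being adjacent when they are distinct
and generate the same principal right ideal or the same principal left ideal. -/
def idempotentGraph (M : Type*) [Mul M] :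
    SimpleGraph {e : M // IsIdempotentElem e ∧ ¬ ∀ x, x * e = e ∧ e * x = e} where
  Adj e f := e ≠ f ∧
    ((e.1 * f.1 = f.1 ∧ f.1 * e.1 = e.1) ∨ (e.1 * f.1 = e.1 ∧ f.1 * e.1 = f.1))
  symm := ⟨fun _ _ h => ⟨h.1.symm, h.2.imp And.symm And.symm⟩⟩
  loopless := ⟨fun _ h => h.1 rfl⟩

/-- Isomorphic semigroups have isomorphic graphs of idempotents. -/
def MulEquiv.idempotentGraphIso {M N : Type*} [Mul M] [Mul N] (φ : M ≃* N) :
    idempotentGraph M ≃g idempotentGraph N where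
  toEquiv := φ.toEquiv.subtypeEquiv fun e => by
    refine and_congr ?_ (not_congr ?_)
    · simp [IsIdempotentElem, ← map_mul]
    · rw [← φ.toEquiv.forall_congr_right]
      simp [← map_mul]
  map_rel_iff' {e f} := by
    simp only [idempotentGraph, Equiv.subtypeEquiv_apply, ne_eq, MulEquiv.toEquiv_eq_coe,
      MulEquiv.coe_toEquiv, ← map_mul, EmbeddingLike.apply_eq_iff_eq, Subtype.ext_iff]

/-- Each non-zero entry p_{li} carries exactly one idempotent (i, p_{li}⁻¹, l), and these are all
the non-zero ones. Two of them generate the same right ideal when they share i and the same left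
ideal when they share l. -/
theorem nonempty_reesGraph_iso_idempotentGraph {H I L : Type*} [Group H]
    (P : L → I → WithZero H) :
    Nonempty (reesGraph P ≃g idempotentGraph (ReesMatrixSemigroup P)) := by
  open ReesMatrixSemigroup in
  let φ : {c : I × L // P c.2 c.1 ≠ 0} → {e : ReesMatrixSemigroup P //
      IsIdempotentElem e ∧ ¬ ∀ x, x * e = e ∧ e * x = e} := fun c =>
    ⟨elem c.1.1 (WithZero.unzero c.2)⁻¹ c.1.2, by
      rw [IsIdempotentElem, elem_mul_elem _ _ _ _ _ _ c.2, inv_mul_cancel, one_mul], fun h => by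
      have := (h zero).1
      rw [zero_mul'] at this
      cases this⟩
  have hφ : Function.Bijective φ := by
    constructor
    · rintro ⟨⟨i, l⟩, hc⟩ ⟨⟨j, m⟩, hd⟩ h
      have h' := ReesMatrixSemigroup.elem.inj (congrArg Subtype.val h)
      exact Subtype.ext (Prod.ext h'.1 h'.2.2)
    · rintro ⟨_ | ⟨i, g, l⟩, he, hz⟩
      · exact absurd (fun x => ⟨mul_zero' x, zero_mul' x⟩) hz
      · by_cases hp : P l i = 0
        · rw [IsIdempotentElem, elem_mul_elem_eq_zero _ _ _ _ _ _ hp] at he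
          cases he
        · refine ⟨⟨(i, l), hp⟩, Subtype.ext ?_⟩
          rw [IsIdempotentElem, elem_mul_elem _ _ _ _ _ _ hp] at he
          have hg := (ReesMatrixSemigroup.elem.inj he).2.1
          rw [mul_eq_right, mul_eq_one_iff_eq_inv] at hg
          simp only [φ, ← hg]
  refine ⟨⟨Equiv.ofBijective φ hφ, fun {c d} => ?_⟩⟩
  obtain ⟨⟨i, l⟩, hc⟩ := c
  obtain ⟨⟨j, m⟩, hd⟩ := d
  simp only [idempotentGraph, reesGraph, Equiv.ofBijective_apply, hφ.1.ne_iff]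
  refine and_congr_right fun _ => or_congr ?_ ?_
  · constructor
    · rintro ⟨h, -⟩
      change (elem i _ l * elem j _ m : ReesMatrixSemigroup P) = elem j _ m at h
      by_cases hp : P l j = 0
      · rw [elem_mul_elem_eq_zero _ _ _ _ _ _ hp] at h
        cases h
      · rw [elem_mul_elem _ _ _ _ _ _ hp] at h
        exact (ReesMatrixSemigroup.elem.inj h).1
    · rintro (rfl : i = j)
      constructor
      · refine (elem_mul_elem _ _ _ _ _ _ hc).trans ?_
        rw [inv_mul_cancel, one_mul]
      · refine (elem_mul_elem _ _ _ _ _ _ hd).trans ?_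
        rw [inv_mul_cancel, one_mul]
  · constructor
    · rintro ⟨h, -⟩
      change (elem i _ l * elem j _ m : ReesMatrixSemigroup P) = elem i _ l at h
      by_cases hp : P l j = 0
      · rw [elem_mul_elem_eq_zero _ _ _ _ _ _ hp] at h
        cases h
      · rw [elem_mul_elem _ _ _ _ _ _ hp] at h
        exact (ReesMatrixSemigroup.elem.inj h).2.2.symm
    · rintro (rfl : l = m)
      constructor
      · refine (elem_mul_elem _ _ _ _ _ _ hd).trans ?_
        rw [mul_assoc, mul_inv_cancel, mul_one]
      · refine (elem_mul_elem _ _ _ _ _ _ hc).trans ?_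
        rw [mul_assoc, mul_inv_cancel, mul_one]

theorem MulEquiv.reesConnected_iff {H I L H' I' L' : Type*} [Group H] [Group H']
    {P : L → I → WithZero H} {P' : L' → I' → WithZero H'}
    (φ : ReesMatrixSemigroup P ≃* ReesMatrixSemigroup P') :
    ReesConnected P ↔ ReesConnected P' := by
  obtain ⟨e⟩ := nonempty_reesGraph_iso_idempotentGraph P
  obtain ⟨e'⟩ := nonempty_reesGraph_iso_idempotentGraph P'
  exact SimpleGraph.Iso.connected_iff ((e.trans φ.idempotentGraphIso).trans e'.symm)

/-- The non-zero entries are the edges of the Houghton graph, so `reesGraph P` is its line graph;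
regularity excludes isolated vertices. -/
theorem reesConnected_iff_houghtonGraph_connected {Ω H : Type*} {G : Subgroup (Equiv.Perm Ω)}
    {Q : Set (Set Ω)} {S : Set Ω} {P : MulAction.orbit G S → MulAction.orbit G Q → WithZero H}
    (hreg : IsRegularMatrix P) (hP : ∀ L K, P L K ≠ 0 ↔ IsTransversalFor L.1 K.1) :
    ReesConnected P ↔ (houghtonGraph G Q S).Connected := by
  have hadj : ∀ L K, P L K ≠ 0 → (houghtonGraph G Q S).Adj (.inl K) (.inr L) :=
    fun L K h => (hP L K).1 h
  constructor
  · intro h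
    have hreach : ∀ c d, (reesGraph P).Reachable c d →
        (houghtonGraph G Q S).Reachable (.inl c.1.1) (.inl d.1.1) := by
      intro c d hcd
      rw [SimpleGraph.reachable_iff_reflTransGen] at hcd
      induction hcd with
      | refl => exact .rfl
      | @tail d e _ hde ih =>
        rcases hde.2 with h1 | h2
        · rwa [← h1]
        · have h1 := (hadj _ _ d.2).reachable
          rw [h2] at h1
          exact (ih.trans h1).trans (hadj _ _ e.2).symm.reachable
    have hex : ∀ v, ∃ c : {c : MulAction.orbit G Q × MulAction.orbit G S // P c.2 c.1 ≠ 0},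
        (houghtonGraph G Q S).Reachable v (.inl c.1.1) := by
      rintro (K | L)
      · obtain ⟨L, hL⟩ := hreg.2 K
        exact ⟨⟨(K, L), hL⟩, .rfl⟩
      · obtain ⟨K, hK⟩ := hreg.1 L
        exact ⟨⟨(K, L), hK⟩, (hadj _ _ hK).symm.reachable⟩
    have : Nonempty (MulAction.orbit G Q ⊕ MulAction.orbit G S) :=
      ⟨.inl ⟨_, MulAction.mem_orbit_self _⟩⟩
    refine ⟨fun v w => ?_⟩
    obtain ⟨c, hc⟩ := hex v
    obtain ⟨d, hd⟩ := hex w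
    exact (hc.trans (hreach c d (h.preconnected c d))).trans hd.symm
  · intro h
    obtain ⟨L₀, h₀⟩ := hreg.2 ⟨_, MulAction.mem_orbit_self _⟩
    have : Nonempty {c : MulAction.orbit G Q × MulAction.orbit G S // P c.2 c.1 ≠ 0} :=
      ⟨⟨(_, L₀), h₀⟩⟩
    have hstep : ∀ c d : {c : MulAction.orbit G Q × MulAction.orbit G S // P c.2 c.1 ≠ 0},
        (c.1.1 = d.1.1 ∨ c.1.2 = d.1.2) → (reesGraph P).Reachable c d := by
      intro c d hcd
      by_cases hne : c = d
      · rw [hne]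
      · exact SimpleGraph.Adj.reachable (G := reesGraph P) ⟨hne, hcd⟩
    refine ⟨fun c d => ?_⟩
    -- The induction along a path carries all edges at the current vertex, so that the edge just
    -- traversed links one vertex to the next.
    have key : ∀ v, (houghtonGraph G Q S).Reachable (.inl c.1.1) v →
        ∀ d : {c : MulAction.orbit G Q × MulAction.orbit G S // P c.2 c.1 ≠ 0},
          (v = .inl d.1.1 ∨ v = .inr d.1.2) → (reesGraph P).Reachable c d := by
      intro v hv
      rw [SimpleGraph.reachable_iff_reflTransGen] at hv
      induction hv with
      | refl =>
        rintro d (hd | hd)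
        · exact hstep c d (Or.inl (Sum.inl.inj hd))
        · cases hd
      | @tail v w _ hvw ih =>
        rcases v with K | L <;> rcases w with K' | L'
        · exact hvw.elim
        · rintro d (hd | hd)
          · cases hd
          · exact (ih ⟨(K, L'), (hP _ _).2 hvw⟩ (Or.inl rfl)).trans
              (hstep _ _ (Or.inr (Sum.inr.inj hd)))
        · rintro d (hd | hd)
          · exact (ih ⟨(K', L), (hP _ _).2 hvw⟩ (Or.inr rfl)).trans
              (hstep _ _ (Or.inl (Sum.inl.inj hd)))
          · cases hd
        · exact hvw.elim
    exact key _ (h.preconnected _ _) d (Or.inl rfl)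

theorem mainTheorem3 {Ω : Type*} [Finite Ω] (G : Subgroup (Equiv.Perm Ω))
    (hG : MulAction.IsPreprimitive G Ω) (t : Function.End Ω) (ht : trRank t = 2)
    (hsing : ¬ Function.Bijective (t : Ω → Ω)) :
    -- idempotent generation is equivalent to connectedness of the Houghton graph
    (IsIdempotentGenerated (genDiff G t) ↔
      (houghtonGraph G (kerPartition t) (Set.range (t : Ω → Ω))).Connected) ∧
    -- the rank 2 maps induce a Rees matrix semigroup over the symmetric group of degree 2
    (∃ P : MulAction.orbit G (Set.range (t : Ω → Ω)) → MulAction.orbit G (kerPartition t) →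
        WithZero (Equiv.Perm (Fin 2)),
      IsRegularMatrix P ∧
      (∀ S Q, P S Q ≠ 0 ↔ IsTransversalFor S.1 Q.1) ∧
      Nonempty (RankFactor (genDiff G t) 2 ≃* ReesMatrixSemigroup P)) ∧
    -- idempotent generation is equivalent to connectedness of the induced Rees matrix semigroup,
    -- whichever way it is represented
    (∀ (H I L : Type*) [Group H] (P : L → I → WithZero H), IsRegularMatrix P →
      Nonempty (RankFactor (genDiff G t) 2 ≃* ReesMatrixSemigroup P) →
      (IsIdempotentGenerated (genDiff G t) ↔ ReesConnected P)) := by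
  have h3 := three_le_card ht hsing
  obtain ⟨c⟩ := Coordinates.nonempty G ht
  have hiff := c.isIdempotentGenerated_iff ht h3
  obtain ⟨φ⟩ := c.nonempty_mulEquiv ht h3
  refine ⟨hiff, ⟨c.matrix, c.isRegularMatrix_matrix, fun _ _ => c.matrix_ne_zero_iff, ⟨φ⟩⟩, ?_⟩
  rintro H I L _ P - ⟨ψ⟩
  rw [hiff, ← reesConnected_iff_houghtonGraph_connected c.isRegularMatrix_matrix
    fun _ _ => c.matrix_ne_zero_iff]
  exact (φ.symm.trans ψ).reesConnected_iff
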